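/- Let $q$ be a prime power, let $n\ge 2$ be an integer, and let $V$ be an $n$-dimensional vector space over the finite field $\mathbb{F}_q$. Write $\binom{n}{k}_q=\prod_{i=0}^{k-1}\frac{q^{n-i}-1}{q^{k-i}-1}$ for the Gaussian binomial coefficient, and let $G_q(n,2)$ be the set of all $2$-dimensional subspaces of $V$. For a family $\mathcal{F}\subseteq G_q(n,2)$ put $$\mathcal{I}(\mathcal{F})=\sum_{A\in\mathcal{F}}\sum_{B\in\mathcal{F}}\dim(A\cap B),\qquad \mathcal{MI}(\mathcal{F})=\max\{\mathcal{I}(\mathcal{G}) : \mathcal{G}\subseteq G_q(n,2),\ |\mathcal{G}|=|\mathcal{F}|\}.$$ (1) If $\mathcal{F}\subseteq G_q(n,2)$ has size $M=|\mathcal{F}|=\binom{n-1}{1}_q$, then $$\mathcal{MI}(\mathcal{F})=\frac{(q^{n-1}+q-2)(q^{n-1}-1)}{(q-1)^2},$$ and, with $k=2$, $$\mathcal{MI}(\mathcal{F})=\left(\frac{\binom{n}{k}_q}{M}-\binom{n}{1}_q\right)\frac{qM^2\binom{k}{1}_q\binom{n-k}{1}_q}{\binom{n}{1}_q\left(\binom{n}{1}_q-1\right)}+kM^2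 .$$ (2) For every $1$-dimensional subspace $L\subseteq V$, the full $1$-star $\mathcal{Y}=\{A\in G_q(n,2) : L\subseteq A\}$ satisfies $|\mathcal{Y}|=\binom{n-1}{1}_q$ and $\mathcal{I}(\mathcal{Y})=\mathcal{MI}(\mathcal{Y})$. -/

import Mathlib

open Module

noncomputable section

/-- The Gaussian binomial coefficient `∏_{i=0}^{k-1} (q^(n-i) - 1) / (q^(k-i) - 1)`.
(For `n < k` the factor with `i = n` makes it `0`.) -/
def gaussBinom (q n k : ℕ) : ℝ :=
  ∏ i ∈ Finset.range k, ((q : ℝ) ^ (n - i) - 1) / ((q : ℝ) ^ (k - i) - 1)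

/-- The set of all `k`-dimensional subspaces of `V`. -/
def subspacesOfDim (K V : Type*) [Field K] [AddCommGroup V] [Module K V] (k : ℕ) :
    Set (Submodule K V) :=
  {U | finrank K U = k}

/-- The total intersection number `∑_{A ∈ F} ∑_{B ∈ F} dim (A ∩ B)` of a family of subspaces. -/
def totalIntersection {K V : Type*} [Field K] [AddCommGroup V] [Module K V]
    (F : Finset (Submodule K V)) : ℕ :=
  ∑ A ∈ F, ∑ B ∈ F, finrank K (A ⊓ B : Submodule K V)

/-- The total intersection numbers of the families `G ⊆ X` with `|G| = |F|`. -/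
def totalIntersectionValues {K V : Type*} [Field K] [AddCommGroup V] [Module K V]
    (X : Set (Submodule K V)) (F : Finset (Submodule K V)) : Set ℕ :=
  totalIntersection '' {G : Finset (Submodule K V) | (G : Set (Submodule K V)) ⊆ X ∧
    G.card = F.card}

/-- The maximal total intersection number among all families in `X` with the same size as `F`.
For finite `V` and `F ⊆ X` the supremum is a maximum, see `isGreatest_maxTotalIntersection`. -/
def maxTotalIntersection {K V : Type*} [Field K] [AddCommGroup V] [Module K V]
    (X : Set (Submodule K V)) (F : Finset (Submodule K V)) : ℕ :=
  sSup (totalIntersectionValues X F)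

theorem isGreatest_maxTotalIntersection {K V : Type*} [Field K] [AddCommGroup V] [Module K V]
    [Finite V] (X : Set (Submodule K V)) (F : Finset (Submodule K V))
    (hF : (F : Set (Submodule K V)) ⊆ X) :
    IsGreatest (totalIntersectionValues X F) (maxTotalIntersection X F) := by
  have hfin : (totalIntersectionValues X F).Finite := (Set.toFinite _).image _
  exact ⟨Nat.sSup_mem ⟨_, F, ⟨hF, rfl⟩, rfl⟩ hfin.bddAbove,
    fun _ ha => le_csSup hfin.bddAbove ha⟩

/-- The full star with centre `U`: the family of all `k`-dimensional subspaces containing `U`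
(a full `t`-star if `dim U = t`). -/
def fullStar {K V : Type*} [Field K] [AddCommGroup V] [Module K V] [Finite V]
    (k : ℕ) (U : Submodule K V) : Finset (Submodule K V) :=
  (Set.toFinite {A : Submodule K V | finrank K A = k ∧ U ≤ A}).toFinset

/-- The linear programming upper bound
`([n,k]/M - [n,1]) * (q M² [k,1] [n-k,1]) / ([n,1] ([n,1] - 1)) + k M²` on the total intersection
number of a family of `M` subspaces of dimension `k` of an `n`-dimensional space. -/
def intersectionBound (q n k M : ℕ) : ℝ :=
  (gaussBinom q n k / M - gaussBinom q n 1) *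
      ((q * (M : ℝ) ^ 2 * gaussBinom q k 1 * gaussBinom q (n - k) 1) /
        (gaussBinom q n 1 * (gaussBinom q n 1 - 1))) +
    k * (M : ℝ) ^ 2

end

section SubspaceCounting

variable {K V : Type*} [Field K] [AddCommGroup V] [Module K V]

/-! Two distinct 2-subspaces meet in dimension at most 1, so a family of `M` of them has total
intersection at most `2M + M(M - 1) = M(M + 1)`. A full 1-star attains this, since any two members
share the centre `L` (`totalIntersection_fullStar_two`). Its members correspond to the points of the
projective space of `V ⧸ L`, so its size is exactly `[n-1,1]` (`card_fullStar_two`). Hence the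
maximum at that size is `M(M + 1)`, and both closed forms are algebraic rewritings of it. -/

lemma finrank_comap_mkQ [FiniteDimensional K V] (L : Submodule K V) (W : Submodule K (V ⧸ L)) :
    finrank K (W.comap L.mkQ) = finrank K W + finrank K L := by
  have h := (L.mkQ.domRestrict (W.comap L.mkQ)).finrank_range_add_finrank_ker
  rw [LinearMap.range_domRestrict, LinearMap.ker_domRestrict, Submodule.ker_mkQ,
    Submodule.map_comap_eq_self (by simp)] at h
  rw [← h]
  exact congrArg _
    (Submodule.comapSubtypeEquivOfLe (Submodule.le_comap_mkQ L W)).finrank_eq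

lemma mem_fullStar [Finite V] {k : ℕ} {U A : Submodule K V} :
    A ∈ fullStar k U ↔ finrank K A = k ∧ U ≤ A := by
  simp [fullStar]

/-- The `k`-subspaces through a `t`-subspace `L` correspond to the `(k - t)`-subspaces of
`V ⧸ L`. -/
lemma card_fullStar_add [Finite V] (L : Submodule K V) (j : ℕ) :
    (fullStar (j + finrank K L) L).card =
      Nat.card {H : Submodule K (V ⧸ L) // finrank K H = j} := by
  rw [← Nat.card_eq_finsetCard]
  symm
  refine Nat.card_eq_of_bijective
    (fun H => ⟨H.1.comap L.mkQ, mem_fullStar.2 ⟨?_, Submodule.le_comap_mkQ L H.1⟩⟩) ⟨?_, ?_⟩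
  · rw [finrank_comap_mkQ, H.2]
  · intro H₁ H₂ h
    exact Subtype.ext (Submodule.comap_injective_of_surjective L.mkQ_surjective
      (congrArg Subtype.val h))
  · rintro ⟨A, hA⟩
    obtain ⟨hA, hL⟩ := mem_fullStar.1 hA
    have hc : (A.map L.mkQ).comap L.mkQ = A := by simpa [Submodule.comap_map_mkQ] using hL
    refine ⟨⟨A.map L.mkQ, ?_⟩, Subtype.ext hc⟩
    have h := finrank_comap_mkQ L (A.map L.mkQ)
    rw [hc, hA] at h
    omega

lemma gaussBinom_one (q m : ℕ) : gaussBinom q m 1 = ((q : ℝ) ^ m - 1) / ((q : ℝ) - 1) := by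
  simp [gaussBinom]

lemma card_fullStar_two [Finite K] [Finite V] (L : Submodule K V) (hL : finrank K L = 1) :
    ((fullStar 2 L).card : ℝ) = gaussBinom (Nat.card K) (finrank K V - 1) 1 := by
  have h := card_fullStar_add L 1
  have hq : (1 : ℝ) < Nat.card K := by exact_mod_cast Finite.one_lt_card
  have hd : finrank K (V ⧸ L) = finrank K V - 1 := by
    have := L.finrank_quotient_add_finrank
    omega
  -- The 1-subspaces of `V ⧸ L` are projective points, counted by a geometric sum.
  rw [hL, ← Nat.card_congr (Projectivization.equivSubmodule K (V ⧸ L)),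
    Projectivization.card_of_finrank K _ hd] at h
  rw [h, gaussBinom_one]
  push_cast
  exact geom_sum_eq hq.ne' _

/-- The summand is the largest possible `dim (A ∩ B)` for 2-subspaces: 2 on the diagonal, 1 off it.
-/
lemma sum_sum_ite_eq_add_one {α : Type*} [DecidableEq α] (F : Finset α) :
    ∑ A ∈ F, ∑ B ∈ F, ((if A = B then 1 else 0) + 1) = F.card * (F.card + 1) := by
  simp [Finset.sum_add_distrib]
  ring

lemma finrank_inf_le_of_finrank_eq_two [FiniteDimensional K V] [DecidableEq (Submodule K V)]
    {A B : Submodule K V} (hA : finrank K A = 2) (hB : finrank K B = 2) :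
    finrank K (A ⊓ B : Submodule K V) ≤ (if A = B then 1 else 0) + 1 := by
  split_ifs with h
  · subst h
    rw [inf_idem, hA]
  · by_contra! hlt
    have h₁ : A ⊓ B = A := Submodule.eq_of_le_of_finrank_le inf_le_left (by omega)
    have h₂ : A ⊓ B = B := Submodule.eq_of_le_of_finrank_le inf_le_right (by omega)
    exact h (h₁.symm.trans h₂)

lemma totalIntersection_le_of_finrank_eq_two [FiniteDimensional K V]
    {F : Finset (Submodule K V)} (hF : (F : Set (Submodule K V)) ⊆ subspacesOfDim K V 2) :
    totalIntersection F ≤ F.card * (F.card + 1) := by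
  classical
  rw [← sum_sum_ite_eq_add_one]
  exact Finset.sum_le_sum fun A hA => Finset.sum_le_sum fun B hB =>
    finrank_inf_le_of_finrank_eq_two (hF hA) (hF hB)

lemma fullStar_subset_subspacesOfDim [Finite V] (k : ℕ) (U : Submodule K V) :
    (fullStar k U : Set (Submodule K V)) ⊆ subspacesOfDim K V k :=
  fun _ hA => (mem_fullStar.1 hA).1

lemma totalIntersection_fullStar_two [Finite V] {L : Submodule K V}
    (hL : finrank K L = 1) :
    totalIntersection (fullStar 2 L) = (fullStar 2 L).card * ((fullStar 2 L).card + 1) := by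
  classical
  rw [← sum_sum_ite_eq_add_one]
  refine Finset.sum_congr rfl fun A hA => Finset.sum_congr rfl fun B hB => ?_
  obtain ⟨hA, hLA⟩ := mem_fullStar.1 hA
  obtain ⟨hB, hLB⟩ := mem_fullStar.1 hB
  refine le_antisymm (finrank_inf_le_of_finrank_eq_two hA hB) ?_
  split_ifs with h
  · subst h
    rw [inf_idem, hA]
  · simpa [hL] using Submodule.finrank_mono (le_inf hLA hLB)

/-- The maximum depends on `F` only through its size, so a star of that size serves as the extremal
family. -/
lemma maxTotalIntersection_eq_of_card_eq [Finite V]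
    {F : Finset (Submodule K V)} (hF : (F : Set (Submodule K V)) ⊆ subspacesOfDim K V 2)
    {L : Submodule K V} (hL : finrank K L = 1) (hcard : F.card = (fullStar 2 L).card) :
    maxTotalIntersection (subspacesOfDim K V 2) F = F.card * (F.card + 1) := by
  refine (isGreatest_maxTotalIntersection _ F hF).unique ⟨⟨fullStar 2 L,
    ⟨fullStar_subset_subspacesOfDim 2 L, hcard.symm⟩, ?_⟩, ?_⟩
  · rw [totalIntersection_fullStar_two hL, hcard]
  · rintro _ ⟨G, ⟨hG, hGF⟩, rfl⟩
    rw [← hGF]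
    exact totalIntersection_le_of_finrank_eq_two hG

lemma exists_submodule_finrank_eq_one [Nontrivial V] :
    ∃ L : Submodule K V, finrank K L = 1 := by
  obtain ⟨v, hv⟩ := exists_ne (0 : V)
  exact ⟨K ∙ v, finrank_span_singleton hv⟩

end SubspaceCounting

/-- Put `N = [n,1]` and `R = [n-2,1]`. Then `N - 1 = qM`, `qR = M - 1` and `[n,2] = NM/(q+1)`. The
first factor of the bound becomes `-qN/(q+1)` and the second `(q+1)MR/N`, with product `-qMR = -M(M
- 1)`; adding `2M²` gives `M(M + 1)`. -/
lemma intersectionBound_two_eq {q n M : ℕ} (hq : 2 ≤ q) (hn : 2 ≤ n)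
    (hM : (M : ℝ) = gaussBinom q (n - 1) 1) :
    intersectionBound q n 2 M = M * (M + 1) := by
  obtain ⟨m, rfl⟩ := Nat.exists_eq_add_of_le' hn
  have hq' : (1 : ℝ) < q := by exact_mod_cast hq
  have h1 : (q : ℝ) - 1 ≠ 0 := by linarith
  have hq1 : (q : ℝ) + 1 ≠ 0 := by linarith
  have hq0 : (q : ℝ) ≠ 0 := by linarith
  have hp1 : (q : ℝ) ^ (m + 1) - 1 ≠ 0 := (sub_pos.2 (one_lt_pow₀ hq' (by omega))).ne'
  have hp2 : (q : ℝ) ^ (m + 2) - 1 ≠ 0 := (sub_pos.2 (one_lt_pow₀ hq' (by omega))).ne'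
  have hN : gaussBinom q (m + 2) 1 - 1 = q * M := by
    rw [hM, gaussBinom_one, gaussBinom_one, show m + 2 - 1 = m + 1 by omega]
    field_simp
    ring
  have hM1 : (q : ℝ) * gaussBinom q m 1 = M - 1 := by
    rw [hM, gaussBinom_one, gaussBinom_one, show m + 2 - 1 = m + 1 by omega]
    field_simp
    ring
  have hM0 : (M : ℝ) ≠ 0 := by
    rw [hM, gaussBinom_one]
    exact div_ne_zero hp1 h1
  have hN0 : gaussBinom q (m + 2) 1 ≠ 0 := by
    rw [gaussBinom_one]
    exact div_ne_zero hp2 h1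
  have h21 : gaussBinom q 2 1 = q + 1 := by
    rw [gaussBinom_one]
    field_simp
    ring
  have hG : gaussBinom q (m + 2) 2 = gaussBinom q (m + 2) 1 * M / (q + 1) := by
    rw [hM, gaussBinom_one, gaussBinom_one, show m + 2 - 1 = m + 1 by omega]
    have h2 : (q : ℝ) ^ 2 - 1 = (q - 1) * (q + 1) := by ring
    simp only [gaussBinom, Finset.prod_range_succ, Finset.prod_range_zero, Nat.sub_zero, one_mul,
      pow_one, show m + 2 - 1 = m + 1 by omega, show 2 - 1 = 1 from rfl, h2]
    field_simp
  rw [intersectionBound, hG, hN, h21, Nat.add_sub_cancel]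
  generalize gaussBinom q (m + 2) 1 = N at *
  generalize gaussBinom q m 1 = R at *
  push_cast
  field_simp
  -- After clearing denominators only `qR = M - 1` is still needed.
  linear_combination -hM1

theorem mainTheorem6 {K V : Type*} [Field K] [Finite K] [AddCommGroup V] [Module K V] [Finite V]
    (q n : ℕ) (hq : Nat.card K = q) (hV : finrank K V = n) (hn : 2 ≤ n) :
    (∀ F : Finset (Submodule K V), (F : Set (Submodule K V)) ⊆ subspacesOfDim K V 2 →
      (F.card : ℝ) = gaussBinom q (n - 1) 1 →
        (maxTotalIntersection (subspacesOfDim K V 2) F : ℝ) =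
            ((q : ℝ) ^ (n - 1) + q - 2) * ((q : ℝ) ^ (n - 1) - 1) / ((q : ℝ) - 1) ^ 2 ∧
          (maxTotalIntersection (subspacesOfDim K V 2) F : ℝ) =
            intersectionBound q n 2 F.card) ∧
    (∀ L : Submodule K V, finrank K L = 1 →
      (fullStar 2 L : Set (Submodule K V)) ⊆ subspacesOfDim K V 2 ∧
        ((fullStar 2 L).card : ℝ) = gaussBinom q (n - 1) 1 ∧
        totalIntersection (fullStar 2 L) =
          maxTotalIntersection (subspacesOfDim K V 2) (fullStar 2 L)) := by
  subst hq hV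
  have hq : 2 ≤ Nat.card K := Finite.one_lt_card
  refine ⟨fun F hF hcard => ?_, fun L hL => ?_⟩
  · have : Nontrivial V := nontrivial_of_finrank_pos (R := K) (by omega)
    obtain ⟨L, hL⟩ := exists_submodule_finrank_eq_one (K := K) (V := V)
    have hFL : F.card = (fullStar 2 L).card := by
      exact_mod_cast hcard.trans (card_fullStar_two L hL).symm
    rw [maxTotalIntersection_eq_of_card_eq hF hL hFL, intersectionBound_two_eq hq hn hcard]
    push_cast
    refine ⟨?_, rfl⟩
    have h1 : (Nat.card K : ℝ) - 1 ≠ 0 := by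
      have : (2 : ℝ) ≤ Nat.card K := by exact_mod_cast hq
      linarith
    rw [hcard, gaussBinom_one]
    field_simp
    ring
  · have hsub := fullStar_subset_subspacesOfDim 2 L
    refine ⟨hsub, card_fullStar_two L hL, ?_⟩
    rw [maxTotalIntersection_eq_of_card_eq hsub hL rfl, totalIntersection_fullStar_two hL]
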